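/- \textbf{Setting.} Let $\mathcal X,\mathcal Y$ be measurable spaces (for instance $\mathcal X\subseteq\mathbb R^d$, $\mathcal Y=\{-1,+1\}$), let $\mathcal Y'$ be a set of predictions, $\ell:\mathcal Y'\times\mathcal Y\to\{0,1\}$ a binary loss, and $\mathcal H$ a measurable space of classifiers $h:\mathcal X\to\mathcal Y'$ such that $(h,x,y)\mapsto\ell(h(x),y)$ is measurable. Let $\mathcal D$ be a probability distribution on $\mathcal X\times\{a,b\}\times\mathcal Y$, and for $g\in\{a,b\}$ let $\mathcal D_{|g}$ be the conditional distribution of $(x,y)$ given that the sensitive attribute equals $g$. For a probability distribution $\rho$ on $\mathcal H$ put $$R_{\mathcal D_{|g}}(G_\rho)=\mathbb E_{h\sim\rho}\,\mathbb E_{(x,y)\sim\mathcal D_{|g}}\,\ell(h(x),y)$$ (with the value $0$ if $g$ has probability $0$ under $\mathcal D$). For a sample $S=\{(x_i,g_i,y_i)\}_{i=1}^m$ let $m_g=\#\{i: g_i=g\}$ and $$\widehat R_{S_{|g}}(G_\rho)=\mathbb E_{h\sim\rho}\,\frac1{m_g}\sum_{i:\,g_i=g}\ell(h(x_i),y_i).$$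 Let $\mathrm{kl}(q\|p)=q\ln\frac qp+(1-q)\ln\frac{1-q}{1-p}\in[0,+\infty]$ for $p,q\in[0,1]$ (with $0\ln\frac 0p=0$ for all $p\in[0,1]$, and $q\ln\frac q0=+\infty$ for $q>0$), and let $\mathrm{KL}(\rho\|\pi)\in[0,+\infty]$ be the Kullback--Leibler divergence. For a probability distribution $\pi$ on $\mathcal H$ and $\delta'\in(0,1]$ define $$\varepsilon_g=\frac1{m_g}\Big[\mathrm{KL}(\rho\|\pi)+\ln\frac{2\sqrt{m_g}}{\delta'}\Big],$$ $$R^{\uparrow}_{S_{|g}}(\rho,\pi,\delta')=\max\big\{r\in[0,1]:\mathrm{kl}\big(\widehat R_{S_{|g}}(G_\rho)\,\big\|\,r\big)\le\varepsilon_g\big\},\qquad R^{\downarrow}_{S_{|g}}(\rho,\pi,\delta')=\min\big\{r\in[0,1]:\mathrm{kl}\big(\widehat R_{S_{|g}}(G_\rho)\,\big\|\,r\big)\le\varepsilon_g\big\},$$ where for an empty subsample ($m_g=0$) one sets $\varepsilon_g=+\infty$, so that $R^{\uparrow}_{S_{|g}}=1$ and $R^{\downarrow}_{S_{|g}}=0$.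 \textbf{Theorem.} For every such $\mathcal D$, $\ell$ and $\mathcal H$, every prior probability distribution $\pi$ on $\mathcal H$, every sample size $m$ and every $\delta\in(0,1]$, with probability at least $1-\delta$ over the i.i.d. sample $S\sim\mathcal D^m$, simultaneously for all probability distributions $\rho$ on $\mathcal H$, $$\big|R_{\mathcal D_{|a}}(G_\rho)-R_{\mathcal D_{|b}}(G_\rho)\big|\le\max\Big\{R^{\uparrow}_{S_{|a}}(\rho,\pi,\tfrac\delta4)-R^{\downarrow}_{S_{|b}}(\rho,\pi,\tfrac\delta4),\ R^{\uparrow}_{S_{|b}}(\rho,\pi,\tfrac\delta4)-R^{\downarrow}_{S_{|a}}(\rho,\pi,\tfrac\delta4)\Big\}.$$ -/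

import Mathlib

open MeasureTheory ProbabilityTheory
open scoped ENNReal

noncomputable section

namespace GroupFairness

/-- The binary sensitive attribute, with values `a` and `b`. -/
inductive SensitiveGroup where
  | a
  | b
  deriving DecidableEq

instance : MeasurableSpace SensitiveGroup := ⊤

/-- The term `q ln (q / p)` of a Kullback-Leibler divergence, with the usual conventions
`0 ln (0 / p) = 0`, and `q ln (q / 0) = +∞` for `q ≠ 0`. -/
def klTerm (q p : ℝ) : EReal :=
  if q = 0 then 0 else if p = 0 then ⊤ else ((q * Real.log (q / p) : ℝ) : EReal)

/-- `kl(q‖p) = q ln (q / p) + (1 - q) ln ((1 - q) / (1 - p))`: the divergence between the Bernoulli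
laws of parameters `q` and `p` in `[0, 1]`. -/
def binKL (q p : ℝ) : EReal :=
  klTerm q p + klTerm (1 - q) (1 - p)

/-- The largest `r ∈ [0, 1]` with `kl(q‖r) ≤ ε`. For `q ∈ [0, 1]` and `ε ≥ 0` the set is compact and
contains `q`, so that its supremum is its maximum. -/
def klInvUpper (q : ℝ) (ε : EReal) : ℝ :=
  sSup {r : ℝ | r ∈ Set.Icc (0 : ℝ) 1 ∧ binKL q r ≤ ε}

/-- The smallest `r ∈ [0, 1]` with `kl(q‖r) ≤ ε`. -/
def klInvLower (q : ℝ) (ε : EReal) : ℝ :=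
  sInf {r : ℝ | r ∈ Set.Icc (0 : ℝ) 1 ∧ binKL q r ≤ ε}

section TrueRisk

variable {X Y Y' H : Type*} [MeasurableSpace X] [MeasurableSpace Y] [MeasurableSpace H]

/-- The law of `(x, y)` given that the sensitive attribute is `g`, for `(x, g, y)` of law `D`.
(It is the zero measure if the group `g` has probability `0`.) -/
def condGroup (D : Measure (X × SensitiveGroup × Y)) (g : SensitiveGroup) : Measure (X × Y) :=
  (ProbabilityTheory.cond D {z | z.2.1 = g}).map (fun z => (z.1, z.2.2))

/-- The true risk `E_{(x, y) ∼ P} ℓ(h(x), y)` of a classifier `h`. -/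
def risk (ℓ : Y' → Y → ℝ) (P : Measure (X × Y)) (h : X → Y') : ℝ :=
  ∫ z, ℓ (h z.1) z.2 ∂P

/-- The true Gibbs risk `E_{h ∼ ρ} E_{(x, y) ∼ P} ℓ(h(x), y)`; the hypotheses are the
classifiers `clf h`, for `h` in `H`. -/
def gibbsRisk (ℓ : Y' → Y → ℝ) (clf : H → X → Y') (P : Measure (X × Y)) (ρ : Measure H) : ℝ :=
  ∫ h, risk ℓ P (clf h) ∂ρ

/-- The true fairness risk of the Gibbs classifier: `|R_{D|a}(G_ρ) - R_{D|b}(G_ρ)|`. -/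
def gibbsFairnessRisk (ℓ : Y' → Y → ℝ) (clf : H → X → Y')
    (D : Measure (X × SensitiveGroup × Y)) (ρ : Measure H) : ℝ :=
  |gibbsRisk ℓ clf (condGroup D SensitiveGroup.a) ρ -
    gibbsRisk ℓ clf (condGroup D SensitiveGroup.b) ρ|

end TrueRisk

section EmpiricalRisk

variable {X Y Y' H : Type*} [MeasurableSpace H] {m : ℕ}

/-- The indices of the examples of the sample `S` that belong to the group `g`. -/
def groupIndices (S : Fin m → X × SensitiveGroup × Y) (g : SensitiveGroup) : Finset (Fin m) :=
  Finset.univ.filter (fun i => (S i).2.1 = g)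

/-- The size `m_g` of the subsample of the group `g`. -/
def groupSize (S : Fin m → X × SensitiveGroup × Y) (g : SensitiveGroup) : ℕ :=
  (groupIndices S g).card

/-- The empirical risk of a classifier `h` on the subsample of the group `g`. -/
def groupEmpRisk (ℓ : Y' → Y → ℝ) (S : Fin m → X × SensitiveGroup × Y) (g : SensitiveGroup)
    (h : X → Y') : ℝ :=
  (1 / (groupSize S g : ℝ)) * ∑ i ∈ groupIndices S g, ℓ (h (S i).1) (S i).2.2

/-- The empirical Gibbs risk on the subsample of the group `g`. -/
def groupEmpGibbsRisk (ℓ : Y' → Y → ℝ) (clf : H → X → Y') (S : Fin m → X × SensitiveGroup × Y)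
    (g : SensitiveGroup) (ρ : Measure H) : ℝ :=
  ∫ h, groupEmpRisk ℓ S g (clf h) ∂ρ

/-- The complexity term `(1 / n) (KL(ρ‖π) + ln (2 √n / δ))` for a sample of size `n`. Without any
example it is `+∞`, so that the bounds below are then the trivial ones, `1` and `0`. -/
def klBudget (n : ℕ) (ρ π : Measure H) (δ : ℝ) : EReal :=
  if n = 0 then ⊤
  else ((1 / (n : ℝ) : ℝ) : EReal) *
    ((InformationTheory.klDiv ρ π : EReal) +
      ((Real.log (2 * Real.sqrt (n : ℝ) / δ) : ℝ) : EReal))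

/-- The upper bound on the Gibbs risk, computed on the subsample of the group `g`. -/
def riskUpper (ℓ : Y' → Y → ℝ) (clf : H → X → Y') (S : Fin m → X × SensitiveGroup × Y)
    (g : SensitiveGroup) (ρ π : Measure H) (δ : ℝ) : ℝ :=
  klInvUpper (groupEmpGibbsRisk ℓ clf S g ρ) (klBudget (groupSize S g) ρ π δ)

/-- The lower bound on the Gibbs risk, computed on the subsample of the group `g`. -/
def riskLower (ℓ : Y' → Y → ℝ) (clf : H → X → Y') (S : Fin m → X × SensitiveGroup × Y)
    (g : SensitiveGroup) (ρ π : Measure H) (δ : ℝ) : ℝ :=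
  klInvLower (groupEmpGibbsRisk ℓ clf S g ρ) (klBudget (groupSize S g) ρ π δ)

end EmpiricalRisk

end GroupFairness

end

/-! For a fixed classifier with true risk `p` on a group, if it makes `k` errors on the `n` examples
of that group, then `exp (n kl(k/n‖p))` is the ratio of the maximal Bernoulli likelihood to the
likelihood at `p`. When this ratio is integrated over samples, the true likelihood cancels and
leaves the normalized maximum likelihood sum of the binomial family, at most `4 √n` by Stirling.
Dividing by `4 √n` inside the expectation makes the bound insensitive to the random size of the
group: no conditioning on the group sizes is needed, since the probabilities of all possible index
sets sum to `1` (`lintegral_scaledRatio_le`).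

By Tonelli and Markov, outside an event of probability at most `δ / 2` the average of the scaled
ratio over `π` is below `2 / δ`. This event does not depend on `ρ`. To pass to `ρ`, the divergence
is written as a supremum of functions affine in `(q, p)`. Each of them is bounded, commutes with
averaging over `ρ`, and has its exponential dominated by the likelihood ratio, so Donsker-Varadhan
applies to it; the supremum is taken last (`binKL_groupEmpGibbsRisk_le`). This replaces Jensen's
inequality for kl and avoids infinite values.

The resulting budget is `ln (4 √n * 2 / δ) = ln (2 √n / (δ / 4))`. One kl inequality confines the
risk of a group from both sides, so a union bound over the two groups suffices, and the loose
constant `4` uses up the remaining factor two in the confidence. -/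

noncomputable section

namespace GroupFairness

/-! ### The normalized maximum likelihood sum of the binomial family -/

/-- The maximum over `p` of `p ^ k * (1 - p) ^ (n - k)`, which is attained at `p = k / n`. -/
def maxLikelihood (n k : ℕ) : ℝ :=
  ((k : ℝ) / n) ^ k * (((n - k : ℕ) : ℝ) / n) ^ (n - k)

lemma maxLikelihood_pos {n k : ℕ} (hk : k ≤ n) : 0 < maxLikelihood n k := by
  unfold maxLikelihood
  rcases Nat.eq_zero_or_pos k with rfl | hk0
  · rcases Nat.eq_zero_or_pos n with rfl | hn
    · simp
    · have : (0 : ℝ) < n := by exact_mod_cast hn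
      simp only [Nat.sub_zero, pow_zero, one_mul]
      positivity
  · have hn : (0 : ℝ) < n := by exact_mod_cast hk0.trans_le hk
    have hk0' : (0 : ℝ) < k := by exact_mod_cast hk0
    rcases Nat.eq_zero_or_pos (n - k) with h | h
    · rw [h]
      simp only [pow_zero, mul_one]
      positivity
    · have : (0 : ℝ) < ((n - k : ℕ) : ℝ) := by exact_mod_cast h
      positivity

/-- The Stirling ratio `n! / (√(2n) (n/e)^n)` decreases for `n ≥ 1`, hence never exceeds its first
value `e / √2`. -/
lemma factorial_le_stirling {n : ℕ} (hn : n ≠ 0) :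
    (n.factorial : ℝ) ≤ Real.exp 1 * √n * (n / Real.exp 1) ^ n := by
  obtain ⟨j, rfl⟩ := Nat.exists_eq_succ_of_ne_zero hn
  have h : Stirling.stirlingSeq (j + 1) ≤ Stirling.stirlingSeq 1 :=
    Stirling.stirlingSeq'_antitone (Nat.zero_le j)
  rw [Stirling.stirlingSeq_one, Stirling.stirlingSeq] at h
  have hpos : (0 : ℝ) < ((j + 1 : ℕ) : ℝ) := by positivity
  rw [div_le_iff₀ (by positivity), Real.sqrt_mul (by norm_num)] at h
  refine h.trans_eq ?_
  have : √(2 : ℝ) ≠ 0 := by positivity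
  rw [Nat.succ_eq_add_one]
  field_simp

/-- With `l = n - k`, Stirling's bounds make the powers cancel and leave `e √n / (2π √k √l)`; then
`√n ≤ √k + √l` separates the two variables. -/
lemma choose_mul_maxLikelihood_le {n k : ℕ} (hk : 0 < k) (hkn : k < n) :
    (n.choose k : ℝ) * maxLikelihood n k ≤ (1 / √k + 1 / √((n - k : ℕ) : ℝ)) / 2 := by
  obtain ⟨l, rfl⟩ := Nat.exists_eq_add_of_lt hkn
  set l' := l + 1 with hl'
  have hsub : k + l + 1 - k = l' := by omega
  have hadd : k + l + 1 = k + l' := by omega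
  rw [maxLikelihood, hsub, hadd]
  clear_value l'
  replace hl' : 0 < l' := by omega
  have hk' : (0 : ℝ) < k := by exact_mod_cast hk
  have hl : (0 : ℝ) < l' := by positivity
  have hn : (0 : ℝ) < ((k + l' : ℕ) : ℝ) := by positivity
  have hfac : ((k + l').choose k : ℝ) * (k.factorial * l'.factorial) = (k + l').factorial := by
    have := Nat.choose_mul_factorial_mul_factorial (Nat.le_add_right k l')
    rw [Nat.add_sub_cancel_left] at this
    rw [← mul_assoc]
    exact_mod_cast this
  have h1 := Stirling.le_factorial_stirling k
  have h2 := Stirling.le_factorial_stirling l'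
  have h3 := factorial_le_stirling (n := k + l') (by omega)
  rw [Real.sqrt_mul (by positivity)] at h1 h2
  set P := √(2 * Real.pi) with hP
  have hPP : P * P = 2 * Real.pi := Real.mul_self_sqrt (by positivity)
  have hE : 0 < Real.exp 1 := Real.exp_pos 1
  have hprod : ((k + l').choose k : ℝ) *
      ((P * √k * (k / Real.exp 1) ^ k) * (P * √l' * (l' / Real.exp 1) ^ l')) ≤
      Real.exp 1 * √((k + l' : ℕ) : ℝ) * (((k + l' : ℕ) : ℝ) / Real.exp 1) ^ (k + l') := by
    refine le_trans ?_ (hfac.le.trans h3)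
    gcongr
  have hsqrt : √((k + l' : ℕ) : ℝ) ≤ √k + √l' := by
    rw [Real.sqrt_le_iff]
    refine ⟨by positivity, ?_⟩
    push_cast
    nlinarith [Real.sq_sqrt hk'.le, Real.sq_sqrt hl.le,
      mul_nonneg (Real.sqrt_nonneg (k : ℝ)) (Real.sqrt_nonneg (l' : ℝ))]
  have hsk : 0 < √(k : ℝ) := Real.sqrt_pos.2 hk'
  have hsl : 0 < √(l' : ℝ) := Real.sqrt_pos.2 hl
  set N : ℝ := ((k + l' : ℕ) : ℝ) with hN
  set C : ℝ := ((k + l').choose k : ℝ) with hC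
  have hprod' : C * ((k / N) ^ k * (l' / N) ^ l') * (2 * Real.pi * (√k * √l')) ≤
      Real.exp 1 * √N := by
    have hfact : C * ((k / N) ^ k * (l' / N) ^ l') * (2 * Real.pi * (√k * √l')) *
        (N / Real.exp 1) ^ (k + l') =
        C * ((P * √k * (k / Real.exp 1) ^ k) * (P * √l' * (l' / Real.exp 1) ^ l')) := by
      rw [← hPP]
      simp only [pow_add, div_pow]
      field_simp
    have hNe : 0 < (N / Real.exp 1) ^ (k + l') := by positivity
    refine le_of_mul_le_mul_right ?_ hNe
    rw [hfact]
    exact hprod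
  -- Since `e ≤ 3 < π`, the factor `e / (2π)` is at most `1 / 2`.
  have hexp : Real.exp 1 ≤ 3 := by linarith [Real.exp_one_lt_d9]
  have hCpos : 0 ≤ C * ((k / N) ^ k * (l' / N) ^ l') := by positivity
  have h6 : C * ((k / N) ^ k * (l' / N) ^ l') * (6 * (√k * √l')) ≤ 3 * (√k + √l') := by
    calc _ ≤ C * ((k / N) ^ k * (l' / N) ^ l') * (2 * Real.pi * (√k * √l')) := by
            gcongr
            linarith [Real.pi_gt_three]
      _ ≤ Real.exp 1 * √N := hprod'
      _ ≤ _ := by gcongr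
  have : (1 / √k + 1 / √(l' : ℝ)) / 2 = 3 * (√k + √l') / (6 * (√k * √l')) := by
    field_simp
    ring
  rw [this, le_div_iff₀ (by positivity)]
  exact h6

/-- Telescoping of `1 / √(n+1) ≤ 2 (√(n+1) - √n)`; the term `k = 0` vanishes because `1 / 0 = 0`. -/
lemma sum_one_div_sqrt_le (n : ℕ) :
    ∑ k ∈ Finset.range (n + 1), 1 / √(k : ℝ) ≤ 2 * √n := by
  induction n with
  | zero => simp
  | succ n ih =>
    rw [Finset.sum_range_succ]
    have hs : 0 < √((n + 1 : ℕ) : ℝ) := Real.sqrt_pos.2 (by positivity)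
    have h1 : √((n + 1 : ℕ) : ℝ) ^ 2 = n + 1 := by
      rw [Real.sq_sqrt (by positivity)]
      push_cast
      rfl
    have h2 : √(n : ℝ) ^ 2 = n := Real.sq_sqrt (by positivity)
    have h3 : 1 / √((n + 1 : ℕ) : ℝ) ≤ 2 * √((n + 1 : ℕ) : ℝ) - 2 * √n := by
      rw [div_le_iff₀ hs]
      nlinarith [sq_nonneg (√((n + 1 : ℕ) : ℝ) - √n)]
    linarith

/-- The interior terms contribute at most `2 √n` and the two extreme ones are `1` each, so the total
is at most `2 √n + 2 ≤ 4 √n`. -/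
theorem sum_choose_mul_maxLikelihood_le {n : ℕ} (hn : n ≠ 0) :
    ∑ k ∈ Finset.range (n + 1), (n.choose k : ℝ) * maxLikelihood n k ≤ 4 * √n := by
  have hn1 : (1 : ℝ) ≤ n := by exact_mod_cast Nat.one_le_iff_ne_zero.2 hn
  have hterm : ∀ k ∈ Finset.range (n + 1), (n.choose k : ℝ) * maxLikelihood n k ≤
      (1 / √k + 1 / √((n - k : ℕ) : ℝ)) / 2 +
        ((if k = 0 then 1 else 0) + (if k = n then 1 else 0)) := by
    intro k hk
    have hnn : (n : ℝ) / n = 1 := div_self (by positivity)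
    rcases Nat.eq_zero_or_pos k with rfl | hk0
    · simp only [maxLikelihood, hn.symm, Nat.sub_zero, hnn, Nat.choose_zero_right, pow_zero,
        one_pow, if_true, if_false]
      norm_num
      positivity
    · rcases (Nat.lt_succ_iff.1 (Finset.mem_range.1 hk)).eq_or_lt with rfl | hkn
      · simp only [maxLikelihood, hn, Nat.sub_self, hnn, Nat.choose_self, pow_zero,
          one_pow, if_true, if_false]
        norm_num
        positivity
      · refine (choose_mul_maxLikelihood_le hk0 hkn).trans ?_
        simp [hk0.ne', hkn.ne]
  refine (Finset.sum_le_sum hterm).trans ?_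
  have hrefl : ∑ k ∈ Finset.range (n + 1), 1 / √((n - k : ℕ) : ℝ) =
      ∑ k ∈ Finset.range (n + 1), 1 / √(k : ℝ) := by
    have := Finset.sum_range_reflect (fun k : ℕ => 1 / √(k : ℝ)) (n + 1)
    simpa using this
  rw [Finset.sum_add_distrib, ← Finset.sum_div, Finset.sum_add_distrib, hrefl,
    Finset.sum_add_distrib]
  simp only [Finset.sum_ite_eq', Finset.mem_range, Nat.lt_succ_self, Nat.succ_pos, if_true]
  have h1 : (1 : ℝ) ≤ √n := Real.one_le_sqrt.2 hn1
  linarith [sum_one_div_sqrt_le n]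

/-! ### The Bernoulli divergence as a supremum of affine functions -/

/-- Half of the domination of exponentiated affine functions by the likelihood ratio. For `k > 0`
and `y = n p t / k`, it is the `k`-th power of `y exp (1 - y) ≤ 1`. -/
lemma exp_mul_pow_le {n k : ℕ} (hkn : k ≤ n) {p t : ℝ} (hp : 0 ≤ p) (ht : 0 < t) :
    Real.exp (k * (Real.log t + 1) - n * p * t) * p ^ k ≤ ((k : ℝ) / n) ^ k := by
  rcases Nat.eq_zero_or_pos k with rfl | hk
  · have : 0 ≤ n * p * t := by positivity
    simpa using this
  have hk' : (0 : ℝ) < k := by exact_mod_cast hk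
  have hn' : (0 : ℝ) < n := by exact_mod_cast hk.trans_le hkn
  have hexp : Real.exp (k * (Real.log t + 1) - n * p * t) =
      (t * Real.exp (1 - n * p * t / k)) ^ k := by
    have htk : t ^ k = Real.exp (k * Real.log t) := by rw [Real.exp_nat_mul, Real.exp_log ht]
    rw [mul_pow, ← Real.exp_nat_mul, htk, ← Real.exp_add]
    congr 1
    field_simp
    ring
  rw [hexp, ← mul_pow]
  refine pow_le_pow_left₀ (by positivity) ?_ k
  set y := n * p * t / k with hy
  have h1 : y * Real.exp (1 - y) ≤ 1 := by
    have := Real.add_one_le_exp (y - 1)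
    have h2 : Real.exp (y - 1) * Real.exp (1 - y) = 1 := by
      rw [← Real.exp_add]
      simp
    nlinarith [Real.exp_pos (1 - y)]
  have h2 : t * Real.exp (1 - y) * p = k / n * (y * Real.exp (1 - y)) := by
    rw [hy]
    field_simp
  rw [h2]
  exact mul_le_of_le_one_right (by positivity) h1

/-- For `q, p > 0` the affine bound is sharp at `t = q / p`. The degenerate cases are the limits `t
→ 0` (for `q = 0`) and `t → ∞` (for `p = 0 < q`), where the hypothesis is contradictory. -/
lemma klTerm_le {q p C : ℝ} (hq : 0 ≤ q) (hp : 0 ≤ p)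
    (h : ∀ t : ℝ, 0 < t → q * (Real.log t + 1) - p * t ≤ C) : klTerm q p ≤ (C : EReal) := by
  unfold klTerm
  split_ifs with h0 h1
  · subst h0
    have : 0 ≤ C := by
      by_contra! hC
      have hp1 : 0 < p + 1 := by linarith
      -- A `t` small enough that `p * t ≤ -C / 2`; the shift by `1` covers `p = 0`.
      have := h (-C / 2 / (p + 1)) (by apply div_pos <;> linarith)
      have h3 : p * (-C / 2 / (p + 1)) ≤ -C / 2 := by
        rw [mul_div_assoc', div_le_iff₀ hp1]
        nlinarith
      linarith
    exact_mod_cast this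
  · subst h1
    have hq' : 0 < q := lt_of_le_of_ne hq (Ne.symm h0)
    have := h (Real.exp (C / q)) (Real.exp_pos _)
    rw [Real.log_exp] at this
    have h3 : q * (C / q + 1) = C + q := by field_simp
    linarith
  · have hq' : 0 < q := lt_of_le_of_ne hq (Ne.symm h0)
    have hp' : 0 < p := lt_of_le_of_ne hp (Ne.symm h1)
    have := h (q / p) (by positivity)
    have h3 : p * (q / p) = q := by field_simp
    have : q * Real.log (q / p) ≤ C := by linarith
    exact_mod_cast this

lemma klTerm_ne_bot (q p : ℝ) : klTerm q p ≠ ⊥ := by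
  unfold klTerm
  split_ifs <;> simp [-EReal.coe_mul]

/-- The variables `t` and `s` are independent, so the suprema can be taken one after the other. The
first shows that `klTerm q p` is finite, which permits the subtraction needed for the second. -/
theorem binKL_le {q p B : ℝ} (hq : q ∈ Set.Icc (0 : ℝ) 1) (hp : p ∈ Set.Icc (0 : ℝ) 1)
    (h : ∀ t s : ℝ, 0 < t → 0 < s →
      (q * (Real.log t + 1) - p * t) + ((1 - q) * (Real.log s + 1) - (1 - p) * s) ≤ B) :
    binKL q p ≤ (B : EReal) := by
  have h1 : ∀ s : ℝ, 0 < s →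
      klTerm q p ≤ ((B - ((1 - q) * (Real.log s + 1) - (1 - p) * s) : ℝ) : EReal) :=
    fun s hs => klTerm_le hq.1 hp.1 fun t ht => by linarith [h t s ht hs]
  have htop : klTerm q p ≠ ⊤ := ne_top_of_le_ne_top (EReal.coe_ne_top _) (h1 1 one_pos)
  obtain ⟨c, hc⟩ : ∃ c : ℝ, klTerm q p = c :=
    ⟨_, (EReal.coe_toReal htop (klTerm_ne_bot q p)).symm⟩
  have h2 : klTerm (1 - q) (1 - p) ≤ ((B - c : ℝ) : EReal) :=
    klTerm_le (by linarith [hq.2]) (by linarith [hp.2]) fun s hs => by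
      have := h1 s hs
      rw [hc, EReal.coe_le_coe_iff] at this
      linarith
  rw [binKL, hc]
  refine (add_le_add_right h2 (c : EReal)).trans ?_
  rw [← EReal.coe_add]
  simp

/-! ### The change of measure inequality -/

/-- The Donsker-Varadhan inequality for bounded functions. -/
theorem integral_le_toReal_klDiv_add_log {H : Type*} [MeasurableSpace H] {ρ π : Measure H}
    [IsProbabilityMeasure ρ] [IsProbabilityMeasure π] (hKL : InformationTheory.klDiv ρ π ≠ ⊤)
    {φ : H → ℝ} (hφ : Measurable φ) {M : ℝ} (hM : ∀ h, |φ h| ≤ M) :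
    ∫ h, φ h ∂ρ ≤ (InformationTheory.klDiv ρ π).toReal + Real.log (∫ h, Real.exp (φ h) ∂π) := by
  obtain ⟨hac, hint⟩ := InformationTheory.klDiv_ne_top_iff.1 hKL
  have hφρ : Integrable φ ρ :=
    Integrable.of_bound hφ.aestronglyMeasurable M (ae_of_all _ hM)
  have hexp : Integrable (fun h => Real.exp (φ h)) π := by
    refine Integrable.of_bound hφ.exp.aestronglyMeasurable (Real.exp M) (ae_of_all _ fun h => ?_)
    rw [Real.norm_eq_abs, Real.abs_exp]
    exact Real.exp_le_exp.2 ((le_abs_self _).trans (hM h))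
  have : IsProbabilityMeasure (π.tilted φ) := isProbabilityMeasure_tilted hexp
  have hac' : ρ ≪ π.tilted φ := hac.trans (absolutelyContinuous_tilted hexp)
  have hint' : Integrable (llr ρ (π.tilted φ)) ρ := integrable_llr_tilted_right hac hφρ hint hexp
  -- The inequality is the nonnegativity of the divergence of `ρ` from the Gibbs measure `π.tilted
  -- φ`.
  have h0 := InformationTheory.integral_llr_add_sub_measure_univ_nonneg hac' hint'
  rw [integral_llr_tilted_right hac hφρ hexp hint] at h0
  rw [InformationTheory.toReal_klDiv_of_measure_eq hac (by simp)]
  simp only [probReal_univ] at h0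
  linarith

/-! ### The expected likelihood ratio on a subsample of random size -/

/-- The ratio of the maximal likelihood to the likelihood at `p` for `k` successes in `n` trials,
divided by `4 √n`. It is `0` for `n = 0`. -/
def scaledRatio (n k : ℕ) (p : ℝ) : ℝ≥0∞ :=
  ENNReal.ofReal (maxLikelihood n k / (4 * √n)) / ENNReal.ofReal (p ^ k * (1 - p) ^ (n - k))

lemma measurable_scaledRatio :
    Measurable fun r : (ℕ × ℕ) × ℝ => scaledRatio r.1.1 r.1.2 r.2 := by
  refine measurable_from_prod_countable_right fun nk => ?_
  simp only [scaledRatio]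
  fun_prop

lemma measurable_scaledRatio_comp {α : Type*} [MeasurableSpace α] {n k : α → ℕ} {p : α → ℝ}
    (hn : Measurable n) (hk : Measurable k) (hp : Measurable p) :
    Measurable fun x => scaledRatio (n x) (k x) (p x) := by
  have := measurable_scaledRatio.comp ((hn.prodMk hk).prodMk hp)
  exact this

/-- Sorting the subsets by cardinality gives the normalized maximum likelihood sum. For empty `A`
the division by `√0` makes the sum `0`. -/
lemma sum_powerset_maxLikelihood_le {ι : Type*} (A : Finset ι) :
    ∑ B ∈ A.powerset, ENNReal.ofReal (maxLikelihood A.card B.card / (4 * √A.card)) ≤ 1 := by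
  rw [← ENNReal.ofReal_sum_of_nonneg, ← ENNReal.ofReal_one]
  · refine ENNReal.ofReal_le_ofReal ?_
    rw [Finset.sum_powerset_apply_card
      (fun k => maxLikelihood A.card k / (4 * √A.card))]
    rcases Nat.eq_zero_or_pos A.card with h | h
    · simp [h]
    · simp only [nsmul_eq_mul, ← mul_div_assoc, ← Finset.sum_div]
      have : (0 : ℝ) < A.card := by exact_mod_cast h
      rw [div_le_one (by positivity)]
      exact sum_choose_mul_maxLikelihood_le h.ne'
  · intro B hB
    have := maxLikelihood_pos (Finset.card_le_card (Finset.mem_powerset.1 hB))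
    positivity

open Classical in
-- Here `G` is the group, `L` the set of errors, `θ` the mass of the group and `p` the conditional
-- risk. Everything is decided by the index sets `A` (group) and `B ⊆ A` (errors), so the integral
-- becomes a finite sum.
theorem lintegral_scaledRatio_le {Z : Type*} [MeasurableSpace Z] (μ : Measure Z)
    [IsProbabilityMeasure μ] {G L : Set Z} (hG : MeasurableSet G) (hL : MeasurableSet L)
    {θ p : ℝ} (hθ : θ ∈ Set.Icc (0 : ℝ) 1) (hp : p ∈ Set.Icc (0 : ℝ) 1)
    (h1 : μ (G ∩ L) = ENNReal.ofReal (θ * p)) (h0 : μ (G \ L) = ENNReal.ofReal (θ * (1 - p)))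
    (hc : μ Gᶜ = ENNReal.ofReal (1 - θ)) (m : ℕ) :
    ∫⁻ S, scaledRatio (Finset.univ.filter fun i => S i ∈ G).card
      (Finset.univ.filter fun i => S i ∈ G ∧ S i ∈ L).card p
      ∂(Measure.pi fun _ : Fin m => μ) ≤ 1 := by
  have hp1 : 0 ≤ 1 - p := by linarith [hp.2]
  have hθ1 : 0 ≤ 1 - θ := by linarith [hθ.2]
  -- The box of samples with index sets exactly `A` and `B`; its product measure factors into the
  -- likelihood at `p` and the probability of `A`.
  set cell : Finset (Fin m) → Finset (Fin m) → Fin m → Set Z :=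
    fun A B i => if i ∈ A then (if i ∈ B then G ∩ L else G \ L) else Gᶜ with hcell
  have hcellm : ∀ A B, MeasurableSet (Set.univ.pi (cell A B)) := by
    intro A B
    refine MeasurableSet.univ_pi fun i => ?_
    simp only [hcell]
    split_ifs
    · exact hG.inter hL
    · exact hG.diff hL
    · exact hG.compl
  have hpoint : ∀ S : Fin m → Z, scaledRatio (Finset.univ.filter fun i => S i ∈ G).card
      (Finset.univ.filter fun i => S i ∈ G ∧ S i ∈ L).card p ≤
      ∑ A : Finset (Fin m), ∑ B ∈ A.powerset,
        (Set.univ.pi (cell A B)).indicator (fun _ => scaledRatio A.card B.card p) S := by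
    intro S
    set A := Finset.univ.filter fun i => S i ∈ G with hA
    set B := Finset.univ.filter fun i => S i ∈ G ∧ S i ∈ L with hB
    have hBA : B ∈ A.powerset := by
      rw [Finset.mem_powerset]
      intro i
      simp only [hA, hB, Finset.mem_filter, Finset.mem_univ, true_and]
      exact fun h => h.1
    have hS : S ∈ Set.univ.pi (cell A B) := by
      intro i _
      simp only [hcell, hA, hB, Finset.mem_filter, Finset.mem_univ, true_and]
      by_cases hi : S i ∈ G <;> by_cases hi' : S i ∈ L <;> simp [hi, hi']
    refine le_trans ?_ (Finset.single_le_sum (f := fun A : Finset (Fin m) =>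
      ∑ B ∈ A.powerset, (Set.univ.pi (cell A B)).indicator
        (fun _ => scaledRatio A.card B.card p) S) (fun _ _ => zero_le) (Finset.mem_univ A))
    refine le_trans ?_ (Finset.single_le_sum (f := fun B : Finset (Fin m) =>
      (Set.univ.pi (cell A B)).indicator
        (fun _ => scaledRatio A.card B.card p) S) (fun _ _ => zero_le) hBA)
    simp only [Set.indicator_of_mem hS, le_refl]
  have hmeas : ∀ A : Finset (Fin m), ∀ B ∈ A.powerset,
      (Measure.pi fun _ : Fin m => μ) (Set.univ.pi (cell A B)) =
        ENNReal.ofReal (p ^ B.card * (1 - p) ^ (A.card - B.card)) *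
          ENNReal.ofReal (θ ^ A.card * (1 - θ) ^ (m - A.card)) := by
    intro A B hB
    have hBA := Finset.mem_powerset.1 hB
    rw [Measure.pi_pi, ← Finset.prod_mul_prod_compl A, ← Finset.prod_sdiff hBA]
    have e1 : ∀ i ∈ A \ B, μ (cell A B i) = ENNReal.ofReal (θ * (1 - p)) := by
      intro i hi
      rw [Finset.mem_sdiff] at hi
      simp [hcell, hi.1, hi.2, h0]
    have e2 : ∀ i ∈ B, μ (cell A B i) = ENNReal.ofReal (θ * p) := by
      intro i hi
      simp [hcell, hi, hBA hi, h1]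
    have e3 : ∀ i ∈ Aᶜ, μ (cell A B i) = ENNReal.ofReal (1 - θ) := by
      intro i hi
      rw [Finset.mem_compl] at hi
      simp [hcell, hi, hc]
    have q0 : 0 ≤ θ * p := mul_nonneg hθ.1 hp.1
    have q1 : 0 ≤ θ * (1 - p) := mul_nonneg hθ.1 hp1
    have q2 : 0 ≤ p ^ B.card * (1 - p) ^ (A.card - B.card) :=
      mul_nonneg (pow_nonneg hp.1 _) (pow_nonneg hp1 _)
    rw [Finset.prod_congr rfl e1, Finset.prod_congr rfl e2, Finset.prod_congr rfl e3]
    simp only [Finset.prod_const, Finset.card_sdiff_of_subset hBA, Finset.card_compl,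
      Fintype.card_fin]
    rw [← ENNReal.ofReal_pow q1, ← ENNReal.ofReal_pow q0, ← ENNReal.ofReal_pow hθ1,
      ← ENNReal.ofReal_mul (pow_nonneg q1 _),
      ← ENNReal.ofReal_mul (mul_nonneg (pow_nonneg q1 _) (pow_nonneg q0 _)),
      ← ENNReal.ofReal_mul q2]
    congr 1
    have hpow : θ ^ A.card = θ ^ (A.card - B.card) * θ ^ B.card := by
      rw [← pow_add, Nat.sub_add_cancel (Finset.card_le_card hBA)]
    rw [hpow, mul_pow, mul_pow]
    ring
  calc _ ≤ ∫⁻ S, ∑ A : Finset (Fin m), ∑ B ∈ A.powerset,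
        (Set.univ.pi (cell A B)).indicator (fun _ => scaledRatio A.card B.card p) S
        ∂(Measure.pi fun _ : Fin m => μ) := lintegral_mono hpoint
    _ = ∑ A : Finset (Fin m), ∑ B ∈ A.powerset, scaledRatio A.card B.card p *
        (Measure.pi fun _ : Fin m => μ) (Set.univ.pi (cell A B)) := by
      rw [lintegral_finsetSum _ fun A _ => Finset.measurable_sum _ fun B _ =>
        measurable_const.indicator (hcellm A B)]
      refine Finset.sum_congr rfl fun A _ => ?_
      rw [lintegral_finsetSum _ fun B _ => measurable_const.indicator (hcellm A B)]
      exact Finset.sum_congr rfl fun B _ => lintegral_indicator_const (hcellm A B) _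
    _ ≤ ∑ A : Finset (Fin m), ∑ B ∈ A.powerset,
        ENNReal.ofReal (maxLikelihood A.card B.card / (4 * √A.card)) *
          ENNReal.ofReal (θ ^ A.card * (1 - θ) ^ (m - A.card)) := by
      refine Finset.sum_le_sum fun A _ => Finset.sum_le_sum fun B hB => ?_
      rw [hmeas A B hB, ← mul_assoc]
      gcongr
      -- Only `≤` holds: where the likelihood at `p` is `0` the ratio is `∞`, but the product `0 *
      -- ∞` is `0`.
      rw [scaledRatio, mul_comm]
      exact ENNReal.mul_div_le
    _ ≤ ∑ A : Finset (Fin m), ENNReal.ofReal (θ ^ A.card * (1 - θ) ^ (m - A.card)) := by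
      refine Finset.sum_le_sum fun A _ => ?_
      rw [← Finset.sum_mul]
      exact mul_le_of_le_one_left' (sum_powerset_maxLikelihood_le A)
    _ = 1 := by
      -- Binomial theorem for `(θ + (1 - θ)) ^ m`, summed over subsets.
      rw [← ENNReal.ofReal_sum_of_nonneg fun A _ =>
        mul_nonneg (pow_nonneg hθ.1 _) (pow_nonneg hθ1 _), Fin.sum_pow_mul_eq_add_pow]
      simp

/-! ### The law of the losses within a group -/

section Counts

variable {X Y Y' : Type*}

/-- The examples of the group `g`. -/
def groupSet (X Y : Type*) (g : SensitiveGroup) : Set (X × SensitiveGroup × Y) :=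
  {z | z.2.1 = g}

/-- The examples misclassified by `h`. -/
def lossSet (ℓ : Y' → Y → ℝ) (h : X → Y') : Set (X × SensitiveGroup × Y) :=
  {z | ℓ (h z.1) z.2.2 = 1}

open Classical in
/-- The number of errors of `h` on the examples of `S` of the group `g`. -/
def groupErrors {m : ℕ} (ℓ : Y' → Y → ℝ) (S : Fin m → X × SensitiveGroup × Y)
    (g : SensitiveGroup) (h : X → Y') : ℕ :=
  (Finset.univ.filter fun i => S i ∈ groupSet X Y g ∧ S i ∈ lossSet ℓ h).card

open Classical in
lemma groupSize_eq {m : ℕ} (S : Fin m → X × SensitiveGroup × Y) (g : SensitiveGroup) :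
    groupSize S g = (Finset.univ.filter fun i => S i ∈ groupSet X Y g).card := by
  unfold groupSize groupIndices groupSet
  congr

lemma groupErrors_le {m : ℕ} (ℓ : Y' → Y → ℝ) (S : Fin m → X × SensitiveGroup × Y)
    (g : SensitiveGroup) (h : X → Y') : groupErrors ℓ S g h ≤ groupSize S g := by
  classical
  rw [groupErrors, groupSize_eq]
  exact Finset.card_le_card fun i => by simpa using fun h _ => h

lemma groupEmpRisk_eq {m : ℕ} {ℓ : Y' → Y → ℝ} (hℓ : ∀ y' y, ℓ y' y = 0 ∨ ℓ y' y = 1)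
    (S : Fin m → X × SensitiveGroup × Y) (g : SensitiveGroup) (h : X → Y') :
    groupEmpRisk ℓ S g h = groupErrors ℓ S g h / groupSize S g := by
  classical
  have hite : ∀ i, ℓ (h (S i).1) (S i).2.2 = if S i ∈ lossSet ℓ h then 1 else 0 := by
    intro i
    split_ifs with hi
    · exact hi
    · exact (hℓ _ _).resolve_right hi
  rw [groupEmpRisk, Finset.sum_congr rfl fun i _ => hite i, Finset.sum_boole, groupErrors,
    groupIndices, Finset.filter_filter, one_div, inv_mul_eq_div]
  congr!

end Counts

section Group

variable {X Y Y' H : Type*} [MeasurableSpace X] [MeasurableSpace Y] [MeasurableSpace H]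

instance (D : Measure (X × SensitiveGroup × Y)) [IsProbabilityMeasure D] (g : SensitiveGroup) :
    IsFiniteMeasure (condGroup D g) := by
  unfold condGroup
  infer_instance

lemma measurableSet_groupSet (g : SensitiveGroup) : MeasurableSet (groupSet X Y g) :=
  (measurable_fst.comp measurable_snd) (MeasurableSpace.measurableSet_top (s := {g}))

lemma measurable_loss {ℓ : Y' → Y → ℝ} {clf : H → X → Y'}
    (hmeas : Measurable (fun p : H × X × Y => ℓ (clf p.1 p.2.1) p.2.2)) (h : H) :
    Measurable fun z : X × Y => ℓ (clf h z.1) z.2 :=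
  hmeas.comp (measurable_const.prodMk measurable_id)

lemma measurableSet_lossSet {ℓ : Y' → Y → ℝ} {clf : H → X → Y'}
    (hmeas : Measurable (fun p : H × X × Y => ℓ (clf p.1 p.2.1) p.2.2)) (h : H) :
    MeasurableSet (lossSet ℓ (clf h) : Set (X × SensitiveGroup × Y)) := by
  have : Measurable fun z : X × SensitiveGroup × Y => ℓ (clf h z.1) z.2.2 :=
    (measurable_loss hmeas h).comp
      (measurable_fst.prodMk (measurable_snd.comp measurable_snd))
  exact this (measurableSet_singleton 1)

/-- A binary loss is the indicator of its error set. For a null group both sides are `0`, by `0⁻¹ =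
0` in the reals. -/
lemma risk_condGroup {ℓ : Y' → Y → ℝ} (hℓ : ∀ y' y, ℓ y' y = 0 ∨ ℓ y' y = 1) {h : X → Y'}
    (hmeas : Measurable fun z : X × Y => ℓ (h z.1) z.2)
    (D : Measure (X × SensitiveGroup × Y)) (g : SensitiveGroup) :
    risk ℓ (condGroup D g) h =
      (D.real (groupSet X Y g))⁻¹ * D.real (groupSet X Y g ∩ lossSet ℓ h) := by
  have hproj : Measurable fun z : X × SensitiveGroup × Y => (z.1, z.2.2) :=
    measurable_fst.prodMk (measurable_snd.comp measurable_snd)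
  have hL : MeasurableSet (lossSet ℓ h : Set (X × SensitiveGroup × Y)) :=
    (hmeas.comp hproj) (measurableSet_singleton 1)
  rw [risk, condGroup, integral_map hproj.aemeasurable hmeas.aestronglyMeasurable]
  have hind : (fun z : X × SensitiveGroup × Y => ℓ (h z.1) z.2.2) =
      (lossSet ℓ h).indicator fun _ => (1 : ℝ) := by
    funext z
    by_cases hz : z ∈ lossSet ℓ h
    · rw [Set.indicator_of_mem hz]
      exact hz
    · rw [Set.indicator_of_notMem hz]
      exact (hℓ _ _).resolve_right hz
  simp only [hind, integral_indicator_const (1 : ℝ) hL, smul_eq_mul, mul_one, measureReal_def]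
  rw [show {z : X × SensitiveGroup × Y | z.2.1 = g} = groupSet X Y g from rfl,
    cond_apply (measurableSet_groupSet g), ENNReal.toReal_mul, ENNReal.toReal_inv]

lemma risk_condGroup_mem_Icc {ℓ : Y' → Y → ℝ} (hℓ : ∀ y' y, ℓ y' y = 0 ∨ ℓ y' y = 1) {h : X → Y'}
    (hmeas : Measurable fun z : X × Y => ℓ (h z.1) z.2)
    (D : Measure (X × SensitiveGroup × Y)) [IsProbabilityMeasure D] (g : SensitiveGroup) :
    risk ℓ (condGroup D g) h ∈ Set.Icc (0 : ℝ) 1 := by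
  rw [risk_condGroup hℓ hmeas]
  refine ⟨by positivity, ?_⟩
  rw [inv_mul_eq_div]
  exact div_le_one_of_le₀ (measureReal_mono Set.inter_subset_left) measureReal_nonneg

lemma measure_group_inter_lossSet {ℓ : Y' → Y → ℝ} (hℓ : ∀ y' y, ℓ y' y = 0 ∨ ℓ y' y = 1)
    {h : X → Y'} (hmeas : Measurable fun z : X × Y => ℓ (h z.1) z.2)
    (D : Measure (X × SensitiveGroup × Y)) [IsProbabilityMeasure D] (g : SensitiveGroup) :
    D.real (groupSet X Y g ∩ lossSet ℓ h) =
      D.real (groupSet X Y g) * risk ℓ (condGroup D g) h := by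
  rw [risk_condGroup hℓ hmeas]
  by_cases h0 : D.real (groupSet X Y g) = 0
  · have : D.real (groupSet X Y g ∩ lossSet ℓ h) ≤ D.real (groupSet X Y g) :=
      measureReal_mono Set.inter_subset_left
    rw [h0, zero_mul]
    exact le_antisymm (this.trans_eq h0) measureReal_nonneg
  · rw [mul_inv_cancel_left₀ h0]

theorem lintegral_group_scaledRatio_le {ℓ : Y' → Y → ℝ} (hℓ : ∀ y' y, ℓ y' y = 0 ∨ ℓ y' y = 1)
    {clf : H → X → Y'} (hmeas : Measurable (fun p : H × X × Y => ℓ (clf p.1 p.2.1) p.2.2))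
    (D : Measure (X × SensitiveGroup × Y)) [IsProbabilityMeasure D] (m : ℕ) (g : SensitiveGroup)
    (h : H) :
    ∫⁻ S, scaledRatio (groupSize S g) (groupErrors ℓ S g (clf h)) (risk ℓ (condGroup D g) (clf h))
      ∂(Measure.pi fun _ : Fin m => D) ≤ 1 := by
  classical
  have hL := measurableSet_lossSet hmeas h
  have hG := measurableSet_groupSet (X := X) (Y := Y) g
  have hinter := measure_group_inter_lossSet hℓ (measurable_loss hmeas h) D g
  simp only [groupErrors, groupSize_eq]
  refine lintegral_scaledRatio_le D hG hL (θ := D.real (groupSet X Y g))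
    ⟨measureReal_nonneg, measureReal_le_one⟩
    (risk_condGroup_mem_Icc hℓ (measurable_loss hmeas h) D g) ?_ ?_ ?_ m
  · rw [← hinter, ofReal_measureReal]
  · rw [mul_sub, mul_one, ← hinter, ← measureReal_inter_add_sdiff (s := groupSet X Y g) hL,
      add_sub_cancel_left, ofReal_measureReal]
  · rw [← probReal_compl_eq_one_sub hG, ofReal_measureReal]

/-! ### Joint measurability in sample and hypothesis, and the exceptional samples. -/

lemma measurable_risk {ℓ : Y' → Y → ℝ} {clf : H → X → Y'}
    (hmeas : Measurable (fun p : H × X × Y => ℓ (clf p.1 p.2.1) p.2.2))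
    (P : Measure (X × Y)) [SFinite P] : Measurable fun h => risk ℓ P (clf h) :=
  (StronglyMeasurable.integral_prod_right (f := fun h (z : X × Y) => ℓ (clf h z.1) z.2)
    hmeas.stronglyMeasurable).measurable

lemma measurable_groupSize (m : ℕ) (g : SensitiveGroup) :
    Measurable fun S : Fin m → X × SensitiveGroup × Y => groupSize S g := by
  classical
  simp only [groupSize_eq, Finset.card_filter]
  refine Finset.measurable_sum _ fun i _ => Measurable.ite ?_ measurable_const measurable_const
  exact measurable_pi_apply i (measurableSet_groupSet g)

lemma measurable_groupErrors {ℓ : Y' → Y → ℝ} {clf : H → X → Y'}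
    (hmeas : Measurable (fun p : H × X × Y => ℓ (clf p.1 p.2.1) p.2.2)) (m : ℕ)
    (g : SensitiveGroup) :
    Measurable fun q : (Fin m → X × SensitiveGroup × Y) × H => groupErrors ℓ q.1 g (clf q.2) := by
  classical
  simp only [groupErrors, Finset.card_filter]
  refine Finset.measurable_sum _ fun i _ => Measurable.ite ?_ measurable_const measurable_const
  have hi : Measurable fun q : (Fin m → X × SensitiveGroup × Y) × H => q.1 i :=
    (measurable_pi_apply i).comp measurable_fst
  have hl : Measurable fun q : (Fin m → X × SensitiveGroup × Y) × H =>
      ℓ (clf q.2 (q.1 i).1) (q.1 i).2.2 :=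
    hmeas.comp (measurable_snd.prodMk ((measurable_fst.comp hi).prodMk
      (measurable_snd.comp (measurable_snd.comp hi))))
  exact (hi (measurableSet_groupSet g)).inter (hl (measurableSet_singleton 1))

lemma measurable_group_scaledRatio {ℓ : Y' → Y → ℝ} {clf : H → X → Y'}
    (hmeas : Measurable (fun p : H × X × Y => ℓ (clf p.1 p.2.1) p.2.2))
    (D : Measure (X × SensitiveGroup × Y)) [IsProbabilityMeasure D] (m : ℕ) (g : SensitiveGroup) :
    Measurable fun q : (Fin m → X × SensitiveGroup × Y) × H =>
      scaledRatio (groupSize q.1 g) (groupErrors ℓ q.1 g (clf q.2))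
        (risk ℓ (condGroup D g) (clf q.2)) := by
  have h2 : Measurable fun q : (Fin m → X × SensitiveGroup × Y) × H => groupSize q.1 g :=
    (measurable_groupSize m g).comp measurable_fst
  have h3 : Measurable fun q : (Fin m → X × SensitiveGroup × Y) × H =>
      risk ℓ (condGroup D g) (clf q.2) :=
    (measurable_risk hmeas (condGroup D g)).comp measurable_snd
  exact measurable_scaledRatio_comp h2 (measurable_groupErrors hmeas m g) h3

/-- The samples whose scaled likelihood ratio in the group `g` has a small average over `π`. -/
def goodSamples (ℓ : Y' → Y → ℝ) (clf : H → X → Y') (D : Measure (X × SensitiveGroup × Y))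
    (π : Measure H) (m : ℕ) (δ : ℝ) (g : SensitiveGroup) :
    Set (Fin m → X × SensitiveGroup × Y) :=
  {S | ∫⁻ h, scaledRatio (groupSize S g) (groupErrors ℓ S g (clf h))
    (risk ℓ (condGroup D g) (clf h)) ∂π < ENNReal.ofReal (2 / δ)}

lemma measurableSet_goodSamples {ℓ : Y' → Y → ℝ} {clf : H → X → Y'}
    (hmeas : Measurable (fun p : H × X × Y => ℓ (clf p.1 p.2.1) p.2.2))
    (D : Measure (X × SensitiveGroup × Y)) [IsProbabilityMeasure D] (π : Measure H)
    [IsProbabilityMeasure π] (m : ℕ) (δ : ℝ) (g : SensitiveGroup) :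
    MeasurableSet (goodSamples ℓ clf D π m δ g) :=
  (Measurable.lintegral_prod_right' (measurable_group_scaledRatio hmeas D m g)) measurableSet_Iio

/-- Markov's inequality at level `2 / δ`. The prior is independent of the sample, so Tonelli reduces
the expectation to that of a single classifier. -/
theorem measure_compl_goodSamples_le {ℓ : Y' → Y → ℝ} (hℓ : ∀ y' y, ℓ y' y = 0 ∨ ℓ y' y = 1)
    {clf : H → X → Y'} (hmeas : Measurable (fun p : H × X × Y => ℓ (clf p.1 p.2.1) p.2.2))
    (D : Measure (X × SensitiveGroup × Y)) [IsProbabilityMeasure D] (π : Measure H)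
    [IsProbabilityMeasure π] (m : ℕ) {δ : ℝ} (hδ : 0 < δ) (g : SensitiveGroup) :
    (Measure.pi fun _ : Fin m => D) (goodSamples ℓ clf D π m δ g)ᶜ ≤ ENNReal.ofReal (δ / 2) := by
  have hjoint := measurable_group_scaledRatio hmeas D m g
  have hmarkov := mul_meas_ge_le_lintegral (μ := Measure.pi fun _ : Fin m => D)
    (Measurable.lintegral_prod_right' (ν := π) hjoint) (ENNReal.ofReal (2 / δ))
  have hbound : ∫⁻ S, ∫⁻ h, scaledRatio (groupSize S g) (groupErrors ℓ S g (clf h))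
      (risk ℓ (condGroup D g) (clf h)) ∂π ∂(Measure.pi fun _ : Fin m => D) ≤ 1 := by
    rw [lintegral_lintegral_swap (f := fun S h => scaledRatio (groupSize S g)
      (groupErrors ℓ S g (clf h)) (risk ℓ (condGroup D g) (clf h))) hjoint.aemeasurable]
    refine (lintegral_mono fun h => lintegral_group_scaledRatio_le hℓ hmeas D m g h).trans ?_
    simp
  have hcompl : (goodSamples ℓ clf D π m δ g)ᶜ = {S | ENNReal.ofReal (2 / δ) ≤
      ∫⁻ h, scaledRatio (groupSize S g) (groupErrors ℓ S g (clf h))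
        (risk ℓ (condGroup D g) (clf h)) ∂π} := by
    ext S
    simp [goodSamples]
  rw [hcompl, show δ / 2 = (2 / δ)⁻¹ by rw [inv_div], ENNReal.ofReal_inv_of_pos (by positivity)]
  refine (ENNReal.le_inv_iff_mul_le).2 ?_
  rw [mul_comm]
  exact hmarkov.trans hbound

end Group

/-! ### The bound on a group -/

section Bound

variable {X Y Y' H : Type*} [MeasurableSpace X] [MeasurableSpace Y] [MeasurableSpace H]

/-- One factor for the errors, with parameter `t`, and one for the correct predictions, with
parameter `s`. Multiplying by the likelihood at `p`, rather than dividing by it, includes `p = 0`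
and `p = 1`. -/
lemma ofReal_exp_le_scaledRatio {n k : ℕ} (hn : n ≠ 0) (hk : k ≤ n) {p : ℝ}
    (hp : p ∈ Set.Icc (0 : ℝ) 1) {t s : ℝ} (ht : 0 < t) (hs : 0 < s) :
    ENNReal.ofReal (Real.exp ((k * (Real.log t + 1) - n * p * t) +
      (((n - k : ℕ) : ℝ) * (Real.log s + 1) - n * (1 - p) * s)) / (4 * √n)) ≤
      scaledRatio n k p := by
  have hp1 : 0 ≤ 1 - p := by linarith [hp.2]
  have hn' : (0 : ℝ) < n := by exact_mod_cast Nat.pos_of_ne_zero hn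
  have hpos := maxLikelihood_pos hk
  have hne : ENNReal.ofReal (maxLikelihood n k / (4 * √n)) ≠ 0 :=
    (ENNReal.ofReal_pos.2 (by positivity)).ne'
  rw [scaledRatio, ENNReal.le_div_iff_mul_le (Or.inr hne) (Or.inl ENNReal.ofReal_ne_top),
    ← ENNReal.ofReal_mul (by positivity)]
  refine ENNReal.ofReal_le_ofReal ?_
  rw [div_mul_eq_mul_div]
  refine div_le_div_of_nonneg_right ?_ (by positivity)
  rw [Real.exp_add, mul_mul_mul_comm, maxLikelihood]
  exact mul_le_mul (exp_mul_pow_le hk hp.1 ht) (exp_mul_pow_le (Nat.sub_le n k) hp1 hs)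
    (by positivity) (by positivity)

lemma gibbsRisk_mem_Icc {ℓ : Y' → Y → ℝ} (hℓ : ∀ y' y, ℓ y' y = 0 ∨ ℓ y' y = 1)
    {clf : H → X → Y'} (hmeas : Measurable (fun p : H × X × Y => ℓ (clf p.1 p.2.1) p.2.2))
    (D : Measure (X × SensitiveGroup × Y)) [IsProbabilityMeasure D] (g : SensitiveGroup)
    (ρ : Measure H) [IsProbabilityMeasure ρ] :
    gibbsRisk ℓ clf (condGroup D g) ρ ∈ Set.Icc (0 : ℝ) 1 := by
  have h01 := fun h => risk_condGroup_mem_Icc hℓ (measurable_loss hmeas h) D g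
  refine ⟨integral_nonneg fun h => (h01 h).1, ?_⟩
  have hint : Integrable (fun h => risk ℓ (condGroup D g) (clf h)) ρ :=
    Integrable.of_mem_Icc 0 1 (measurable_risk hmeas _).aemeasurable (ae_of_all _ h01)
  simpa [gibbsRisk] using integral_mono hint (integrable_const 1) fun h => (h01 h).2

/-- An empty group or an infinite divergence gives an infinite budget. Otherwise Donsker-Varadhan is
applied for each fixed `t`, `s`, on a set of samples chosen independently of `ρ`, `t` and `s`. -/
theorem binKL_groupEmpGibbsRisk_le {ℓ : Y' → Y → ℝ} (hℓ : ∀ y' y, ℓ y' y = 0 ∨ ℓ y' y = 1)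
    {clf : H → X → Y'} (hmeas : Measurable (fun p : H × X × Y => ℓ (clf p.1 p.2.1) p.2.2))
    (D : Measure (X × SensitiveGroup × Y)) [IsProbabilityMeasure D] (π : Measure H)
    [IsProbabilityMeasure π] {m : ℕ} {δ : ℝ} (hδ : 0 < δ) {g : SensitiveGroup}
    {S : Fin m → X × SensitiveGroup × Y} (hS : S ∈ goodSamples ℓ clf D π m δ g)
    (ρ : Measure H) [IsProbabilityMeasure ρ] :
    binKL (groupEmpGibbsRisk ℓ clf S g ρ) (gibbsRisk ℓ clf (condGroup D g) ρ) ≤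
      klBudget (groupSize S g) ρ π (δ / 4) := by
  unfold klBudget
  split_ifs with hn
  · exact le_top
  set n := groupSize S g with hn_def
  have hn' : (0 : ℝ) < n := by exact_mod_cast Nat.pos_of_ne_zero hn
  by_cases hKL : InformationTheory.klDiv ρ π = ⊤
  · rw [hKL, EReal.coe_ennreal_top, EReal.top_add_coe, EReal.coe_mul_top_of_pos (by positivity)]
    exact le_top
  rw [← EReal.coe_ennreal_toReal hKL, ← EReal.coe_add, ← EReal.coe_mul]
  set p : H → ℝ := fun h => risk ℓ (condGroup D g) (clf h) with hp_def
  set q : H → ℝ := fun h => groupEmpRisk ℓ S g (clf h) with hq_def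
  have hkn : ∀ h, groupErrors ℓ S g (clf h) ≤ n := fun h => groupErrors_le ℓ S g (clf h)
  have hq_eq : ∀ h, q h = groupErrors ℓ S g (clf h) / n := fun h => groupEmpRisk_eq hℓ S g (clf h)
  have hp01 : ∀ h, p h ∈ Set.Icc (0 : ℝ) 1 :=
    fun h => risk_condGroup_mem_Icc hℓ (measurable_loss hmeas h) D g
  have hq01 : ∀ h, q h ∈ Set.Icc (0 : ℝ) 1 := fun h => by
    rw [hq_eq]
    exact ⟨by positivity, div_le_one_of_le₀ (by exact_mod_cast hkn h) hn'.le⟩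
  have hpm : Measurable p := measurable_risk hmeas _
  have hqm : Measurable q := by
    rw [show q = fun h => (groupErrors ℓ S g (clf h) : ℝ) / n from funext hq_eq]
    exact (measurable_from_top.comp
      ((measurable_groupErrors hmeas m g).comp measurable_prodMk_left)).div_const _
  have hpint : Integrable p ρ := Integrable.of_mem_Icc 0 1 hpm.aemeasurable (ae_of_all _ hp01)
  have hqint : Integrable q ρ := Integrable.of_mem_Icc 0 1 hqm.aemeasurable (ae_of_all _ hq01)
  have hQ01 : ∫ h, q h ∂ρ ∈ Set.Icc (0 : ℝ) 1 := by
    refine ⟨integral_nonneg fun h => (hq01 h).1, ?_⟩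
    simpa using integral_mono hqint (integrable_const 1) fun h => (hq01 h).2
  refine binKL_le hQ01 (gibbsRisk_mem_Icc hℓ hmeas D g ρ) fun t s ht hs => ?_
  set φ : H → ℝ := fun h => n * ((q h * (Real.log t + 1) - p h * t) +
    ((1 - q h) * (Real.log s + 1) - (1 - p h) * s)) with hφ_def
  have hφm : Measurable φ := by
    simp only [hφ_def]
    fun_prop
  have hφM : ∀ h, |φ h| ≤ n * ((|Real.log t + 1| + t) + (|Real.log s + 1| + s)) := by
    intro h
    have key : ∀ u v c r : ℝ, u ∈ Set.Icc (0 : ℝ) 1 → v ∈ Set.Icc (0 : ℝ) 1 → 0 < r →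
        |u * c - v * r| ≤ |c| + r := by
      intro u v c r hu hv hr
      refine (abs_sub _ _).trans ?_
      rw [abs_mul, abs_mul, abs_of_nonneg hu.1, abs_of_nonneg hv.1, abs_of_pos hr]
      exact add_le_add (mul_le_of_le_one_left (abs_nonneg _) hu.2)
        (mul_le_of_le_one_left hr.le hv.2)
    have hcompl : ∀ u : ℝ, u ∈ Set.Icc (0 : ℝ) 1 → 1 - u ∈ Set.Icc (0 : ℝ) 1 :=
      fun u hu => ⟨by linarith [hu.2], by linarith [hu.1]⟩
    rw [hφ_def, abs_mul, Nat.abs_cast]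
    refine mul_le_mul_of_nonneg_left ((abs_add_le _ _).trans ?_) hn'.le
    exact add_le_add (key _ _ _ _ (hq01 h) (hp01 h) ht)
      (key _ _ _ _ (hcompl _ (hq01 h)) (hcompl _ (hp01 h)) hs)
  have hDV := integral_le_toReal_klDiv_add_log hKL hφm hφM
  have hφint : ∫ h, φ h ∂ρ = n * (((∫ h, q h ∂ρ) * (Real.log t + 1) - (∫ h, p h ∂ρ) * t) +
      ((1 - ∫ h, q h ∂ρ) * (Real.log s + 1) - (1 - ∫ h, p h ∂ρ) * s)) := by
    have h1 : ∀ h, φ h = q h * (n * ((Real.log t + 1) - (Real.log s + 1))) +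
        p h * (n * (s - t)) + n * (Real.log s + 1 - s) := fun h => by
      simp only [hφ_def]
      ring
    simp only [h1]
    have h2 : Integrable (fun h => q h * (n * ((Real.log t + 1) - (Real.log s + 1))) +
        p h * (n * (s - t))) ρ := (hqint.mul_const _).add (hpint.mul_const _)
    rw [integral_add h2 (integrable_const _),
      integral_add (hqint.mul_const _) (hpint.mul_const _), integral_mul_const,
      integral_mul_const, integral_const]
    simp only [probReal_univ, smul_eq_mul]
    ring
  -- The constant is `4 √n * (2 / δ)`: the scaling of the ratio times the Markov level.
  have hexp : ∫ h, Real.exp (φ h) ∂π ≤ 2 * √n / (δ / 4) := by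
    have hlin : ∫⁻ h, ENNReal.ofReal (Real.exp (φ h) / (4 * √n)) ∂π ≤ ENNReal.ofReal (2 / δ) := by
      refine (lintegral_mono fun h => ?_).trans (le_of_lt hS)
      refine le_trans (le_of_eq ?_) (ofReal_exp_le_scaledRatio hn (hkn h) (hp01 h) ht hs)
      have hk : (groupErrors ℓ S g (clf h) : ℝ) = n * q h := by
        rw [hq_eq]
        field_simp
      rw [Nat.cast_sub (hkn h), hk]
      simp only [hφ_def]
      congr 3
      ring
    have hle := ENNReal.toReal_le_of_le_ofReal (by positivity) hlin
    rw [← integral_eq_lintegral_of_nonneg_ae (ae_of_all _ fun h => by positivity)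
      (hφm.exp.div_const _).aestronglyMeasurable, integral_div, div_le_iff₀ (by positivity)] at hle
    refine hle.trans_eq ?_
    field_simp
  have hpos : 0 < ∫ h, Real.exp (φ h) ∂π := by
    refine integral_exp_pos (Integrable.of_bound hφm.exp.aestronglyMeasurable
      (Real.exp (n * ((|Real.log t + 1| + t) + (|Real.log s + 1| + s)))) (ae_of_all _ fun h => ?_))
    rw [Real.norm_eq_abs, Real.abs_exp]
    exact Real.exp_le_exp.2 ((le_abs_self _).trans (hφM h))
  have hlog := Real.log_le_log hpos hexp
  rw [hφint] at hDV
  rw [one_div, inv_mul_eq_div, le_div_iff₀ hn', mul_comm]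
  exact hDV.trans (by gcongr)

theorem gibbsRisk_mem_Icc_riskLower_riskUpper {ℓ : Y' → Y → ℝ}
    (hℓ : ∀ y' y, ℓ y' y = 0 ∨ ℓ y' y = 1)
    {clf : H → X → Y'} (hmeas : Measurable (fun p : H × X × Y => ℓ (clf p.1 p.2.1) p.2.2))
    (D : Measure (X × SensitiveGroup × Y)) [IsProbabilityMeasure D] (π : Measure H)
    [IsProbabilityMeasure π] {m : ℕ} {δ : ℝ} (hδ : 0 < δ) {g : SensitiveGroup}
    {S : Fin m → X × SensitiveGroup × Y} (hS : S ∈ goodSamples ℓ clf D π m δ g)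
    (ρ : Measure H) [IsProbabilityMeasure ρ] :
    gibbsRisk ℓ clf (condGroup D g) ρ ∈
      Set.Icc (riskLower ℓ clf S g ρ π (δ / 4)) (riskUpper ℓ clf S g ρ π (δ / 4)) :=
  have hmem := And.intro (gibbsRisk_mem_Icc hℓ hmeas D g ρ)
    (binKL_groupEmpGibbsRisk_le hℓ hmeas D π hδ hS ρ)
  ⟨csInf_le ⟨0, fun _ hr => hr.1.1⟩ hmem, le_csSup ⟨1, fun _ hr => hr.1.2⟩ hmem⟩

end Bound

end GroupFairness

end

/-! ### Union bound over the two groups. -/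

theorem mainTheorem2 {X Y Y' H : Type*}
    [MeasurableSpace X] [MeasurableSpace Y] [MeasurableSpace H]
    (ℓ : Y' → Y → ℝ) (hℓ : ∀ y' y, ℓ y' y = 0 ∨ ℓ y' y = 1)
    (clf : H → X → Y')
    (hmeas : Measurable (fun p : H × X × Y => ℓ (clf p.1 p.2.1) p.2.2))
    (D : Measure (X × GroupFairness.SensitiveGroup × Y)) [IsProbabilityMeasure D]
    (π : Measure H) [IsProbabilityMeasure π]
    (m : ℕ) (δ : ℝ) (hδ : 0 < δ) (hδ1 : δ ≤ 1) :
    ∃ E : Set (Fin m → X × GroupFairness.SensitiveGroup × Y),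
      MeasurableSet E ∧
      ENNReal.ofReal (1 - δ) ≤ (Measure.pi (fun _ : Fin m => D)) E ∧
      ∀ S ∈ E, ∀ ρ : Measure H, IsProbabilityMeasure ρ →
        GroupFairness.gibbsFairnessRisk ℓ clf D ρ ≤
          max
            (GroupFairness.riskUpper ℓ clf S GroupFairness.SensitiveGroup.a ρ π (δ / 4) -
              GroupFairness.riskLower ℓ clf S GroupFairness.SensitiveGroup.b ρ π (δ / 4))
            (GroupFairness.riskUpper ℓ clf S GroupFairness.SensitiveGroup.b ρ π (δ / 4) -
              GroupFairness.riskLower ℓ clf S GroupFairness.SensitiveGroup.a ρ π (δ / 4)) := by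
  have hmE := GroupFairness.measurableSet_goodSamples hmeas D π m δ
  have hE := (hmE .a).inter (hmE .b)
  refine ⟨_, hE, ?_, ?_⟩
  · have hcompl := (measure_union_le _ _).trans (add_le_add
      (GroupFairness.measure_compl_goodSamples_le hℓ hmeas D π m hδ .a)
      (GroupFairness.measure_compl_goodSamples_le hℓ hmeas D π m hδ .b))
    rw [← Set.compl_inter, ← ENNReal.ofReal_add (by positivity) (by positivity), add_halves,
      prob_compl_eq_one_sub hE] at hcompl
    rw [ENNReal.ofReal_sub _ hδ.le, ENNReal.ofReal_one, tsub_le_iff_tsub_le]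
    exact hcompl
  · rintro S ⟨hSa, hSb⟩ ρ _
    have ha := GroupFairness.gibbsRisk_mem_Icc_riskLower_riskUpper hℓ hmeas D π hδ hSa ρ
    have hb := GroupFairness.gibbsRisk_mem_Icc_riskLower_riskUpper hℓ hmeas D π hδ hSb ρ
    rw [GroupFairness.gibbsFairnessRisk, abs_sub_le_iff]
    -- Each sign of the difference is bounded by the upper end of one interval minus the lower end
    -- of the other.
    exact ⟨le_max_of_le_left (sub_le_sub ha.2 hb.1), le_max_of_le_right (sub_le_sub hb.2 ha.1)⟩
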